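/- Let $(\Xi,\mathscr M)$ be a measurable space and $H$ a separable (real or complex) Hilbert space. Let $\mathscr K$ be the space of compact operators $H\to H$ with the operator norm $\|\cdot\|$. For $A\in\mathscr K$ and $k\ge 1$ put $\sigma_k(A)=\inf\{\|A-L\| : L\in\mathscr K,\ \operatorname{rank}(L)\le k-1\}$ (the singular values), let $\|A\|_{\mathrm{HS}}=\big(\sum_{k\ge1}\sigma_k(A)^2\big)^{1/2}\in[0,\infty]$, and let $\mathscr H=\{A\in\mathscr K:\|A\|_{\mathrm{HS}}<\infty\}$ with the norm $\|\cdot\|_{\mathrm{HS}}$. Spaces with a norm carry their norm topology and its Borel $\sigma$-algebra. Fix an integer $n\ge 1$. (1) Let $\xi\mapsto A_\xi\in\mathscr K$ be a measurable map on $\Xi$ with $\operatorname{rank}(A_\xi)\ge n$ for all $\xi\in\Xi$. Then there exist measurable maps $s_i:\Xi\to[0,\infty)$, $u_i:\Xi\to H$, $v_i:\Xi\to H$, $i=1,\dots,n$, such that for all $\xi\in\Xi$ and all $i,j$: $s_i(\xi)=\sigma_i(A_\xi)$, $\langle u_i(\xi),u_j(\xi)\rangle=\langle v_i(\xi),v_j(\xi)\rangle=\delta_{i,j}$,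 and $$\Big\|A_\xi-\sum_{i=1}^n s_i(\xi)\langle\cdot,u_i(\xi)\rangle v_i(\xi)\Big\|=\inf_{L\in\mathscr K,\ \operatorname{rank}(L)\le n}\|A_\xi-L\|.$$ Furthermore, if $\Xi$ is also a topological space and $\xi\mapsto A_\xi\in\mathscr K$ is continuous, then $s_1,\dots,s_n$ are continuous. (2) The same holds with $(\mathscr K,\|\cdot\|)$ replaced by $(\mathscr H,\|\cdot\|_{\mathrm{HS}})$ in the assumptions on $\xi\mapsto A_\xi$ and in the optimality identity (the singular values $\sigma_i$ being the same as before). -/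

import Mathlib

open scoped ENNReal NNReal

namespace ParamSVD

variable (𝕜 : Type*) [RCLike 𝕜] (H : Type*) [NormedAddCommGroup H] [InnerProductSpace 𝕜 H]

/-- The space of compact operators `H → H`, with the operator norm and its Borel sigma-algebra. -/
abbrev CompactOp : Type _ := compactOperator (RingHom.id 𝕜) H H

variable {𝕜 H}

/-- The rank of a bounded operator: the (cardinal) dimension of its image. -/
noncomputable def rank (A : H →L[𝕜] H) : Cardinal :=
  LinearMap.rank (A : H →ₗ[𝕜] H)

/-- The singular values, numbered from zero: `singularValue A k` is the infimum of `‖A - L‖` over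
the compact operators `L` of rank at most `k`. In the numbering that starts at one this is
`σ_{k+1}(A) = inf {‖A - L‖ : L compact, rank L ≤ (k + 1) - 1}`. -/
noncomputable def singularValue (A : H →L[𝕜] H) (k : ℕ) : ℝ :=
  sInf {r : ℝ | ∃ L : H →L[𝕜] H, IsCompactOperator L ∧ rank L ≤ (k : Cardinal) ∧ r = ‖A - L‖}

/-- The Hilbert-Schmidt (Schatten-2) norm `(∑ σ_k(A)²)^(1/2)`, with values in `[0, ∞]`. -/
noncomputable def hsNorm (A : H →L[𝕜] H) : ℝ≥0∞ :=
  (∑' k : ℕ, ENNReal.ofReal (singularValue A k) ^ (2 : ℕ)) ^ (1 / 2 : ℝ)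

variable (𝕜 H) in
/-- The space of Hilbert-Schmidt operators: the compact operators with square-summable
singular values. -/
def HSOp : Type _ :=
  {A : H →L[𝕜] H // IsCompactOperator A ∧ Summable fun k : ℕ => singularValue A k ^ 2}

/-- A Hilbert-Schmidt operator, seen as a bounded operator. -/
def HSOp.toCLM (A : HSOp 𝕜 H) : H →L[𝕜] H := A.1

/-- The topology of the Hilbert-Schmidt norm: a set is open if it contains, around each of its
points, a ball for the distance `hsNorm (B - A)`. -/
instance : TopologicalSpace (HSOp 𝕜 H) where
  IsOpen U := ∀ A ∈ U, ∃ ε : ℝ≥0∞, 0 < ε ∧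
    ∀ B : HSOp 𝕜 H, hsNorm (B.toCLM - A.toCLM) < ε → B ∈ U
  isOpen_univ := fun _ _ => ⟨1, one_pos, fun _ _ => Set.mem_univ _⟩
  isOpen_inter := by
    intro U V hU hV A hA
    obtain ⟨ε, hε, h⟩ := hU A hA.1
    obtain ⟨δ, hδ, h'⟩ := hV A hA.2
    exact ⟨min ε δ, lt_min hε hδ, fun B hB =>
      ⟨h B (hB.trans_le (min_le_left _ _)), h' B (hB.trans_le (min_le_right _ _))⟩⟩
  isOpen_sUnion := by
    intro S hS A ⟨U, hU, hA⟩
    obtain ⟨ε, hε, h⟩ := hS U hU A hA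
    exact ⟨ε, hε, fun B hB => ⟨U, hU, h B hB⟩⟩

/-- The Borel sigma-algebra of the Hilbert-Schmidt norm. -/
instance : MeasurableSpace (HSOp 𝕜 H) := borel _

instance : BorelSpace (HSOp 𝕜 H) := ⟨rfl⟩

/-- The operator `x ↦ ∑ i, s i * ⟨x, u i⟩ • v i`, the inner product being linear in `x`. -/
noncomputable def svdSum {n : ℕ} (s : Fin n → ℝ≥0) (u v : Fin n → H) : H →L[𝕜] H :=
  ∑ i, ((s i : ℝ) : 𝕜) • InnerProductSpace.rankOne 𝕜 (v i) (u i)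

end ParamSVD

namespace ParamSVD

open Filter Topology ContinuousLinearMap InnerProductSpace

/-! ### Approximation numbers, Schur complements and deflation. -/

section SingularValues

variable {𝕜 : Type*} [RCLike 𝕜] {H : Type*} [NormedAddCommGroup H] [InnerProductSpace 𝕜 H]

/-! A nonzero compact operator attains its norm on a unit pair `(u, v)` with `A u = ‖A‖ v` and `A† v
= ‖A‖ u`. Subtracting `‖A‖ ⟨·, u⟩ v` shifts the singular values by one (`singularValue_deflate`):
from a competitor for `A`, a Schur complement makes one for the deflated operator, of rank one less
and no worse in norm. After `n` deflations the residual has singular values `σ_{k+n}(A)`. For every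
compact `L` of rank at most `n` these are bounded by those of `A - L`, index by index, so one
residual is optimal in both norms.

Measurability rests on the mean ergodic theorem. The top right singular vectors span the fixed space
of the contraction `‖A‖⁻² A† A`; its Birkhoff averages converge strongly to the projection onto that
space, which is therefore measurable in the parameter. The first vector of a dense sequence with
nonzero projection yields a measurable `u` (`exists_isTopSingularPair`).

Singular values are 1-Lipschitz in the operator norm, which the Hilbert-Schmidt norm dominates; this
gives the continuity claims. -/

theorem rank_add_le (A B : H →L[𝕜] H) : rank (A + B) ≤ rank A + rank B :=
  LinearMap.rank_add_le (A : H →ₗ[𝕜] H) B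

theorem rank_smul_rankOne_le_one (c : 𝕜) (v u : H) : rank (c • rankOne 𝕜 v u) ≤ 1 := by
  refine (Submodule.rank_mono (t := Submodule.span 𝕜 {v}) ?_).trans (rank_span_le _) |>.trans ?_
  · rintro _ ⟨x, rfl⟩
    simp only [coe_coe, _root_.smul_apply, rankOne_apply, smul_smul]
    exact Submodule.smul_mem _ _ (Submodule.mem_span_singleton_self v)
  · simp

theorem isCompactOperator_rankOne (v u : H) : IsCompactOperator (rankOne 𝕜 v u) := by
  rw [rankOne_def']
  exact (isCompactOperator_of_locallyCompactSpace_rng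
    (ContinuousLinearMap.toSpanSingleton 𝕜 v)).comp_clm (innerSL 𝕜 u)

theorem isCompactOperator_smul_rankOne (c : 𝕜) (v u : H) :
    IsCompactOperator (c • rankOne 𝕜 v u) :=
  (isCompactOperator_rankOne v u).smul c

theorem bddBelow_singularValue_set (A : H →L[𝕜] H) (k : ℕ) :
    BddBelow {r : ℝ | ∃ L : H →L[𝕜] H, IsCompactOperator L ∧ rank L ≤ (k : Cardinal) ∧
      r = ‖A - L‖} :=
  ⟨0, by rintro _ ⟨L, -, -, rfl⟩; exact norm_nonneg _⟩

theorem rank_zero_le (c : Cardinal) : rank (0 : H →L[𝕜] H) ≤ c := by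
  have : rank (0 : H →L[𝕜] H) = 0 := LinearMap.rank_zero
  simp [this]

theorem nonempty_singularValue_set (A : H →L[𝕜] H) (k : ℕ) :
    {r : ℝ | ∃ L : H →L[𝕜] H, IsCompactOperator L ∧ rank L ≤ (k : Cardinal) ∧
      r = ‖A - L‖}.Nonempty :=
  ⟨_, 0, isCompactOperator_zero, rank_zero_le _, rfl⟩

theorem singularValue_le {A L : H →L[𝕜] H} {k : ℕ} (hL : IsCompactOperator L)
    (hr : rank L ≤ (k : Cardinal)) : singularValue A k ≤ ‖A - L‖ :=
  csInf_le (bddBelow_singularValue_set A k) ⟨L, hL, hr, rfl⟩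

theorem le_singularValue {A : H →L[𝕜] H} {k : ℕ} {b : ℝ}
    (h : ∀ L : H →L[𝕜] H, IsCompactOperator L → rank L ≤ (k : Cardinal) → b ≤ ‖A - L‖) :
    b ≤ singularValue A k :=
  le_csInf (nonempty_singularValue_set A k) (by rintro _ ⟨L, hL, hr, rfl⟩; exact h L hL hr)

theorem singularValue_nonneg (A : H →L[𝕜] H) (k : ℕ) : 0 ≤ singularValue A k :=
  le_singularValue fun _ _ _ => norm_nonneg _

theorem singularValue_zero (A : H →L[𝕜] H) : singularValue A 0 = ‖A‖ := by
  refine le_antisymm ?_ (le_singularValue fun L _ hr => ?_)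
  · simpa using singularValue_le (A := A) (k := 0) isCompactOperator_zero (rank_zero_le _)
  · have h0 : LinearMap.range (L : H →ₗ[𝕜] H) = ⊥ := by
      rw [← Submodule.rank_eq_zero]
      simpa [rank, LinearMap.rank] using hr
    have : L = 0 := by
      ext x
      have : (L : H →ₗ[𝕜] H) = 0 := LinearMap.range_eq_bot.1 h0
      exact congrArg (fun f : H →ₗ[𝕜] H => f x) this
    simp [this]

theorem singularValue_le_add_norm_sub (A B : H →L[𝕜] H) (k : ℕ) :
    singularValue A k ≤ singularValue B k + ‖A - B‖ := by
  rw [← sub_le_iff_le_add]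
  refine le_singularValue fun L hL hr => ?_
  rw [sub_le_iff_le_add]
  calc singularValue A k ≤ ‖A - L‖ := singularValue_le hL hr
    _ = ‖(B - L) + (A - B)‖ := by congr 1; abel
    _ ≤ _ := norm_add_le _ _

theorem continuous_singularValue (k : ℕ) :
    Continuous fun A : H →L[𝕜] H => singularValue A k := by
  refine LipschitzWith.continuous (K := 1) (LipschitzWith.of_le_add fun A B => ?_)
  rw [dist_eq_norm]
  exact singularValue_le_add_norm_sub A B k

/-- A competitor `M` for `A - L` turns into the competitor `M + L` for `A`. This is the lower bound
behind Hilbert-Schmidt optimality. -/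
theorem singularValue_add_le_sub (A : H →L[𝕜] H) {L : H →L[𝕜] H} {n : ℕ}
    (hL : IsCompactOperator L) (hr : rank L ≤ (n : Cardinal)) (k : ℕ) :
    singularValue A (k + n) ≤ singularValue (A - L) k := by
  refine le_singularValue fun M hM hMr => ?_
  rw [sub_sub, add_comm L M]
  refine singularValue_le (hM.add hL) ((rank_add_le M L).trans ?_)
  rw [Nat.cast_add]
  exact add_le_add hMr hr

theorem singularValue_eq_zero {A : H →L[𝕜] H} {n k : ℕ} (hA : IsCompactOperator A)
    (hr : rank A ≤ (n : Cardinal)) (hnk : n ≤ k) : singularValue A k = 0 :=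
  le_antisymm (by simpa using singularValue_le (A := A) hA (hr.trans (Nat.cast_le.2 hnk)))
    (singularValue_nonneg A k)

/-- The Schur complement of `L` with respect to the entry `⟪v, L u⟫`. -/
noncomputable def schurComplement (L : H →L[𝕜] H) (u v : H) : H →L[𝕜] H :=
  L - (inner 𝕜 v (L u))⁻¹ • (rankOne 𝕜 (L u) v ∘L L)

theorem inner_schurComplement {L : H →L[𝕜] H} {u v : H} (h : inner 𝕜 v (L u) ≠ 0) (x : H) :
    inner 𝕜 v (schurComplement L u v x) = 0 := by
  simp only [schurComplement, _root_.sub_apply, _root_.smul_apply,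
    ContinuousLinearMap.comp_apply, rankOne_apply, inner_sub_right, inner_smul_right]
  field_simp
  ring

theorem isCompactOperator_schurComplement {L : H →L[𝕜] H} (hL : IsCompactOperator L) (u v : H) :
    IsCompactOperator (schurComplement L u v) :=
  hL.sub ((hL.clm_comp (rankOne 𝕜 (L u) v)).smul _)

/-- The new range lies in the range of `L` and in the orthogonal complement of `v`, so it misses `L
u`: the inclusion is strict. -/
theorem rank_schurComplement_le {L : H →L[𝕜] H} {u v : H} (h : inner 𝕜 v (L u) ≠ 0) {k : ℕ}
    (hr : rank L ≤ ((k + 1 : ℕ) : Cardinal)) :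
    rank (schurComplement L u v) ≤ (k : Cardinal) := by
  have hfin : Module.rank 𝕜 (LinearMap.range (L : H →ₗ[𝕜] H)) < Cardinal.aleph0 :=
    hr.trans_lt Cardinal.natCast_lt_aleph0
  have : FiniteDimensional 𝕜 (LinearMap.range (L : H →ₗ[𝕜] H)) :=
    Module.rank_lt_aleph0_iff.1 hfin
  have hlt : LinearMap.range (schurComplement L u v : H →ₗ[𝕜] H) <
      LinearMap.range (L : H →ₗ[𝕜] H) := by
    refine lt_of_le_not_ge ?_ fun hle => ?_
    · rintro _ ⟨x, rfl⟩
      refine ⟨x - ((inner 𝕜 v (L u))⁻¹ * inner 𝕜 v (L x)) • u, ?_⟩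
      simp [schurComplement, smul_smul]
    · obtain ⟨x, hx⟩ := hle ⟨u, rfl⟩
      apply h
      have hx' : schurComplement L u v x = L u := hx
      rw [← hx', inner_schurComplement h]
  have hfr := Submodule.finrank_lt_finrank_of_lt hlt
  have : FiniteDimensional 𝕜 (LinearMap.range (schurComplement L u v : H →ₗ[𝕜] H)) :=
    Submodule.finiteDimensional_of_le hlt.le
  have h1 : Module.finrank 𝕜 (LinearMap.range (L : H →ₗ[𝕜] H)) ≤ k + 1 := by
    have : (Module.finrank 𝕜 (LinearMap.range (L : H →ₗ[𝕜] H)) : Cardinal) ≤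
        ((k + 1 : ℕ) : Cardinal) := by
      rw [Module.finrank_eq_rank]
      exact hr
    exact_mod_cast this
  change Module.rank 𝕜 (LinearMap.range (schurComplement L u v : H →ₗ[𝕜] H)) ≤ _
  rw [← Module.finrank_eq_rank]
  exact_mod_cast (by omega : _ ≤ k)

/-- A unit pair `(u, v)` on which the operator norm of `A` is attained. -/
structure IsTopSingularPair [CompleteSpace H] (A : H →L[𝕜] H) (u v : H) : Prop where
  norm_left : ‖u‖ = 1
  norm_right : ‖v‖ = 1
  apply_left : A u = ((‖A‖ : ℝ) : 𝕜) • v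
  adjoint_apply_right : adjoint A v = ((‖A‖ : ℝ) : 𝕜) • u

/-- The operator `A` with the contribution of the singular pair `(u, v)` removed. -/
noncomputable def deflate (A : H →L[𝕜] H) (u v : H) : H →L[𝕜] H :=
  A - ((‖A‖ : ℝ) : 𝕜) • rankOne 𝕜 v u

theorem deflate_apply (A : H →L[𝕜] H) (u v x : H) :
    deflate A u v x = A x - ((‖A‖ : ℝ) : 𝕜) • (inner 𝕜 u x : 𝕜) • v := rfl

theorem le_rank_deflate {A : H →L[𝕜] H} {u v : H} {n : ℕ}
    (hn : ((n + 1 : ℕ) : Cardinal) ≤ rank A) : (n : Cardinal) ≤ rank (deflate A u v) := by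
  have h1 : rank A ≤ rank (deflate A u v) + 1 := by
    calc rank A = rank (deflate A u v + ((‖A‖ : ℝ) : 𝕜) • rankOne 𝕜 v u) := by
          rw [deflate, sub_add_cancel]
      _ ≤ rank (deflate A u v) + rank (((‖A‖ : ℝ) : 𝕜) • rankOne 𝕜 v u) := rank_add_le _ _
      _ ≤ _ := by gcongr; exact rank_smul_rankOne_le_one _ v u
  have h2 := hn.trans h1
  rw [Nat.cast_succ] at h2
  exact (Cardinal.add_le_add_iff_of_lt_aleph0 (Cardinal.one_lt_aleph0)).1 h2

theorem isCompactOperator_deflate {A : H →L[𝕜] H} (hA : IsCompactOperator A) (u v : H) :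
    IsCompactOperator (deflate A u v) :=
  hA.sub (isCompactOperator_smul_rankOne _ v u)

variable [CompleteSpace H]

theorem adjoint_deflate_apply (A : H →L[𝕜] H) (u v x : H) :
    adjoint (deflate A u v) x = adjoint A x - ((‖A‖ : ℝ) : 𝕜) • (inner 𝕜 v x : 𝕜) • u := by
  simp [deflate, map_smulₛₗ]

namespace IsTopSingularPair

variable {A : H →L[𝕜] H} {u v : H} (h : IsTopSingularPair A u v)
include h

theorem inner_apply (x : H) : inner 𝕜 v (A x) = (‖A‖ : ℝ) * inner 𝕜 u x := by
  rw [← adjoint_inner_left, h.adjoint_apply_right, inner_smul_left]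
  simp

theorem deflate_apply_left : deflate A u v u = 0 := by
  simp [deflate_apply, h.apply_left, inner_self_eq_norm_sq_to_K, h.norm_left]

theorem adjoint_deflate_apply_right : adjoint (deflate A u v) v = 0 := by
  simp [adjoint_deflate_apply, h.adjoint_apply_right, inner_self_eq_norm_sq_to_K, h.norm_right]

theorem inner_deflate (x : H) : inner 𝕜 v (deflate A u v x) = 0 := by
  rw [← adjoint_inner_left, h.adjoint_deflate_apply_right, inner_zero_left]

/-- Moving `x` along `u` to the `w` with `L w = schurComplement L u v x` gives `(A - L) w = z + ‖A‖
y v`, where `z ⟂ v` is the vector to be bounded and `y` is the `u`-coordinate of `w`. By Pythagoras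
on both sides, the `y` terms can be discarded because `‖A - L‖ < ‖A‖`. -/
theorem norm_deflate_sub_schurComplement_le {L : H →L[𝕜] H} (hlt : ‖A - L‖ < ‖A‖) :
    inner 𝕜 v (L u) ≠ 0 ∧ ‖deflate A u v - schurComplement L u v‖ ≤ ‖A - L‖ := by
  -- If this entry vanished, `⟪v, (A - L) u⟫` would equal `‖A‖`, too large for `A - L`.
  have ha : inner 𝕜 v (L u) ≠ 0 := by
    intro h0
    have h1 : inner 𝕜 v ((A - L) u) = ((‖A‖ : ℝ) : 𝕜) := by
      rw [_root_.sub_apply, inner_sub_right, h0, h.inner_apply,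
        inner_self_eq_norm_sq_to_K, h.norm_left]
      simp
    have h2 : ‖A‖ ≤ ‖A - L‖ := by
      calc ‖A‖ = ‖(inner 𝕜 v ((A - L) u) : 𝕜)‖ := by rw [h1]; simp
        _ ≤ ‖v‖ * ‖(A - L) u‖ := norm_inner_le_norm _ _
        _ ≤ ‖v‖ * (‖A - L‖ * ‖u‖) := by gcongr; exact le_opNorm _ _
        _ = ‖A - L‖ := by rw [h.norm_left, h.norm_right]; ring
    exact absurd h2 (not_le.2 hlt)
  refine ⟨ha, opNorm_le_bound _ (norm_nonneg _) fun x => ?_⟩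
  set y : 𝕜 := inner 𝕜 u x - (inner 𝕜 v (L u))⁻¹ * inner 𝕜 v (L x) with hy
  set x₀ : H := x - (inner 𝕜 u x : 𝕜) • u with hx₀
  have hux₀ : inner 𝕜 u x₀ = (0 : 𝕜) := by
    simp [hx₀, inner_sub_right, inner_smul_right, inner_self_eq_norm_sq_to_K, h.norm_left]
  set w : H := x₀ + y • u with hw
  have hxw : w = x - ((inner 𝕜 v (L u))⁻¹ * inner 𝕜 v (L x)) • u := by
    rw [hw, hx₀, hy, sub_smul]; abel
  set z : H := (deflate A u v - schurComplement L u v) x with hz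
  have hvz : inner 𝕜 v z = (0 : 𝕜) := by
    rw [hz, _root_.sub_apply, inner_sub_right, h.inner_deflate,
      inner_schurComplement ha, sub_zero]
  have hnorm_add : ∀ (a e : H) (c : 𝕜), ‖e‖ = 1 → inner 𝕜 e a = (0 : 𝕜) →
      ‖a + c • e‖ ^ 2 = ‖a‖ ^ 2 + ‖c‖ ^ 2 := by
    intro a e c he hea
    have h0 : inner 𝕜 a (c • e) = (0 : 𝕜) := by
      rw [inner_smul_right, inner_eq_zero_symm.1 hea, mul_zero]
    rw [sq, norm_add_sq_eq_norm_sq_add_norm_sq_of_inner_eq_zero _ _ h0, norm_smul, he]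
    ring
  have hEw : (A - L) w = z + (((‖A‖ : ℝ) : 𝕜) * y) • v := by
    have hLw : L w = schurComplement L u v x := by
      rw [hxw]; simp [schurComplement, smul_smul]
    have hAw : A w = deflate A u v x + (((‖A‖ : ℝ) : 𝕜) * y) • v := by
      rw [hxw, map_sub, map_smul, h.apply_left, deflate_apply, hy, mul_sub, sub_smul, smul_smul,
        smul_smul, mul_comm (((‖A‖ : ℝ) : 𝕜)) ((inner 𝕜 v (L u))⁻¹ * _)]
      abel
    rw [_root_.sub_apply, hLw, hAw, hz, _root_.sub_apply]
    abel
  have h1 : ‖z‖ ^ 2 + (‖A‖ * ‖y‖) ^ 2 ≤ ‖A - L‖ ^ 2 * (‖x₀‖ ^ 2 + ‖y‖ ^ 2) := by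
    have e1 := hnorm_add z v (((‖A‖ : ℝ) : 𝕜) * y) h.norm_right hvz
    have e2 := hnorm_add x₀ u y h.norm_left hux₀
    rw [norm_mul, RCLike.norm_ofReal, abs_norm] at e1
    rw [← e1, ← hEw, ← e2, ← mul_pow]
    gcongr
    exact le_opNorm _ _
  have h2 : ‖x₀‖ ^ 2 ≤ ‖x‖ ^ 2 := by
    have e := hnorm_add x₀ u (inner 𝕜 u x) h.norm_left hux₀
    rw [hx₀, sub_add_cancel, ← hx₀] at e
    rw [e]
    linarith [sq_nonneg ‖(inner 𝕜 u x : 𝕜)‖]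
  have h3 : ‖A - L‖ ^ 2 * ‖y‖ ^ 2 ≤ ‖A‖ ^ 2 * ‖y‖ ^ 2 := by gcongr
  have h4 : ‖A - L‖ ^ 2 * ‖x₀‖ ^ 2 ≤ ‖A - L‖ ^ 2 * ‖x‖ ^ 2 := by gcongr
  refine le_of_sq_le_sq ?_ (by positivity)
  rw [mul_pow]
  rw [mul_pow] at h1
  linarith

theorem norm_deflate_le : ‖deflate A u v‖ ≤ ‖A‖ := by
  refine opNorm_le_bound _ (norm_nonneg _) fun x => ?_
  have e : deflate A u v x + (((‖A‖ : ℝ) : 𝕜) * inner 𝕜 u x) • v = A x := by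
    rw [deflate_apply, smul_smul, sub_add_cancel]
  have h0 : inner 𝕜 (deflate A u v x) ((((‖A‖ : ℝ) : 𝕜) * inner 𝕜 u x) • v) = (0 : 𝕜) := by
    rw [inner_smul_right, inner_eq_zero_symm.1 (h.inner_deflate x), mul_zero]
  have := norm_add_sq_eq_norm_sq_add_norm_sq_of_inner_eq_zero _ _ h0
  rw [e] at this
  refine le_trans ?_ (le_opNorm A x)
  refine le_of_sq_le_sq ?_ (norm_nonneg _)
  rw [sq, sq, this]
  exact le_add_of_nonneg_right (mul_self_nonneg _)

/-- Competitors with `‖A - L‖ ≥ ‖A‖` are no better than zero is for the deflated operator; the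
others are handled by Schur complements. -/
theorem singularValue_deflate (k : ℕ) :
    singularValue (deflate A u v) k = singularValue A (k + 1) := by
  refine le_antisymm (le_singularValue fun L hL hr => ?_) ?_
  · rcases lt_or_ge ‖A - L‖ ‖A‖ with hlt | hge
    · obtain ⟨ha, hle⟩ := h.norm_deflate_sub_schurComplement_le hlt
      exact (singularValue_le (isCompactOperator_schurComplement hL u v)
        (rank_schurComplement_le ha hr)).trans hle
    · have := singularValue_le (A := deflate A u v) (k := k) isCompactOperator_zero
        (rank_zero_le _)
      rw [sub_zero] at this
      exact (this.trans h.norm_deflate_le).trans hge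
  · exact singularValue_add_le_sub A (isCompactOperator_smul_rankOne _ v u)
      (by simpa using rank_smul_rankOne_le_one _ v u) k

end IsTopSingularPair

end SingularValues

/-! ### Norm attainment for compact operators. -/

section TopSingularVector

variable {𝕜 : Type*} [RCLike 𝕜] {H : Type*} [NormedAddCommGroup H] [InnerProductSpace 𝕜 H]
  [CompleteSpace H]

/-- The operator `‖A‖⁻² • A† A`; its fixed points are the top right singular vectors of `A`. -/
noncomputable def normalizedGram (A : H →L[𝕜] H) : H →L[𝕜] H :=
  (((‖A‖ ^ 2)⁻¹ : ℝ) : 𝕜) • (adjoint A ∘L A)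

theorem normalizedGram_apply (A : H →L[𝕜] H) (x : H) :
    normalizedGram A x = (((‖A‖ ^ 2)⁻¹ : ℝ) : 𝕜) • adjoint A (A x) := rfl

theorem norm_normalizedGram_le_one (A : H →L[𝕜] H) : ‖normalizedGram A‖ ≤ 1 := by
  rw [normalizedGram, norm_smul, norm_adjoint_comp_self, RCLike.norm_ofReal,
    abs_of_nonneg (by positivity), ← sq]
  exact inv_mul_le_one

theorem isTopSingularPair_of_normalizedGram_apply_eq {A : H →L[𝕜] H} (hA : A ≠ 0) {u : H}
    (hu : ‖u‖ = 1) (hfix : normalizedGram A u = u) :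
    IsTopSingularPair A u (((‖A‖⁻¹ : ℝ) : 𝕜) • A u) := by
  have hc : ‖A‖ ≠ 0 := norm_ne_zero_iff.2 hA
  have hc' : ((‖A‖ : ℝ) : 𝕜) ≠ 0 := RCLike.ofReal_ne_zero.2 hc
  have hAA : adjoint A (A u) = ((‖A‖ : ℝ) : 𝕜) • ((‖A‖ : ℝ) : 𝕜) • u := by
    conv_rhs => rw [← hfix, normalizedGram_apply]
    rw [smul_smul, smul_smul]
    push_cast
    rw [show ((‖A‖ : ℝ) : 𝕜) * ((‖A‖ : ℝ) : 𝕜) * (((‖A‖ : ℝ) : 𝕜) ^ 2)⁻¹ = 1 by field_simp,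
      one_smul]
  have hnorm : ‖A u‖ = ‖A‖ := by
    have h1 : ‖A u‖ ^ 2 = ‖A‖ ^ 2 := by
      have h2 : (inner 𝕜 (A u) (A u) : 𝕜) = ((‖A‖ : ℝ) : 𝕜) ^ 2 := by
        rw [← adjoint_inner_right, hAA, inner_smul_right, inner_smul_right,
          inner_self_eq_norm_sq_to_K, hu]
        simp [sq]
      rw [inner_self_eq_norm_sq_to_K] at h2
      exact_mod_cast h2
    exact (sq_eq_sq₀ (norm_nonneg _) (norm_nonneg _)).1 h1
  refine ⟨hu, ?_, ?_, ?_⟩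
  · rw [norm_smul, RCLike.norm_ofReal, hnorm, abs_of_nonneg (by positivity),
      inv_mul_cancel₀ hc]
  · rw [smul_smul, ← RCLike.ofReal_mul, mul_inv_cancel₀ hc, RCLike.ofReal_one, one_smul]
  · rw [map_smul, hAA, smul_smul, ← RCLike.ofReal_mul, inv_mul_cancel₀ hc, RCLike.ofReal_one,
      one_smul]

/-- Expanding the square makes a norm-maximizing sequence of unit vectors asymptotically fixed. -/
theorem norm_normalizedGram_sub_self_sq_le (A : H →L[𝕜] H) (x : H) :
    ‖normalizedGram A x - x‖ ^ 2 ≤ 2 * (‖x‖ ^ 2 - (‖A‖ ^ 2)⁻¹ * ‖A x‖ ^ 2) := by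
  have h1 : RCLike.re (inner 𝕜 (normalizedGram A x) x) = (‖A‖ ^ 2)⁻¹ * ‖A x‖ ^ 2 := by
    rw [normalizedGram_apply, inner_smul_left, adjoint_inner_left, inner_self_eq_norm_sq_to_K,
      RCLike.conj_ofReal]
    norm_cast
  rw [@norm_sub_sq 𝕜, h1]
  have h2 : ‖normalizedGram A x‖ ≤ ‖x‖ := by
    simpa using le_of_opNorm_le _ (norm_normalizedGram_le_one A) x
  have h3 : ‖normalizedGram A x‖ ^ 2 ≤ ‖x‖ ^ 2 := by gcongr
  linarith

/-- A nonzero compact operator attains its norm: `A† A` has a unit eigenvector for `‖A‖²`. -/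
theorem exists_normalizedGram_apply_eq {A : H →L[𝕜] H} (hA : IsCompactOperator A) (h0 : A ≠ 0) :
    ∃ u : H, ‖u‖ = 1 ∧ normalizedGram A u = u := by
  have hc : 0 < ‖A‖ := norm_pos_iff.2 h0
  have hK : IsCompactOperator (normalizedGram A) :=
    (hA.clm_comp (adjoint A)).smul _
  have hx : ∀ m : ℕ, ∃ x : H, ‖x‖ = 1 ∧ ‖A‖ * (1 - 1 / ((m : ℝ) + 1)) < ‖A x‖ := by
    intro m
    have hpos : (0 : ℝ) < 1 / ((m : ℝ) + 1) := by positivity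
    have hle : 1 / ((m : ℝ) + 1) ≤ 1 := by
      rw [div_le_one (by positivity)]; linarith [(Nat.cast_nonneg m : (0 : ℝ) ≤ m)]
    have hnn : 0 ≤ ‖A‖ * (1 - 1 / ((m : ℝ) + 1)) := mul_nonneg hc.le (by linarith)
    have hlt : NNReal.mk _ hnn < ‖A‖₊ := by
      rw [← NNReal.coe_lt_coe]
      change ‖A‖ * (1 - 1 / ((m : ℝ) + 1)) < ‖A‖
      nlinarith
    obtain ⟨x, hx, hxA⟩ := A.exists_nnnorm_eq_one_lt_apply_of_lt_opNNNorm hlt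
    exact ⟨x, congrArg NNReal.toReal hx, NNReal.coe_lt_coe.2 hxA⟩
  choose x hx1 hxA using hx
  have hnormA : Tendsto (fun m => ‖A (x m)‖) atTop (𝓝 ‖A‖) := by
    refine tendsto_of_tendsto_of_tendsto_of_le_of_le ?_ tendsto_const_nhds
      (fun m => (hxA m).le) (fun m => by simpa [hx1 m] using le_opNorm A (x m))
    simpa using (tendsto_const_nhds (x := ‖A‖)).mul
      ((tendsto_const_nhds (x := (1 : ℝ))).sub tendsto_one_div_add_atTop_nhds_zero_nat)
  have hdiff : Tendsto (fun m => normalizedGram A (x m) - x m) atTop (𝓝 0) := by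
    have hlim : Tendsto (fun m => 2 * (‖x m‖ ^ 2 - (‖A‖ ^ 2)⁻¹ * ‖A (x m)‖ ^ 2)) atTop (𝓝 0) := by
      have := ((tendsto_const_nhds (x := (1 : ℝ))).sub
        ((hnormA.pow 2).const_mul ((‖A‖ ^ 2)⁻¹))).const_mul 2
      rw [inv_mul_cancel₀ (by positivity), sub_self, mul_zero] at this
      simpa [hx1] using this
    have hsq : Tendsto (fun m => ‖normalizedGram A (x m) - x m‖ ^ 2) atTop (𝓝 0) :=
      squeeze_zero (fun _ => by positivity)
        (fun m => norm_normalizedGram_sub_self_sq_le A (x m)) hlim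
    rw [tendsto_zero_iff_norm_tendsto_zero]
    simpa using hsq.sqrt
  obtain ⟨K, hKc, hKsub⟩ := hK.image_closedBall_subset_compact
    (f := ((normalizedGram A : H →L[𝕜] H) : H →ₗ[𝕜] H)) 1
  obtain ⟨y, -, φ, hφ, hy⟩ := hKc.tendsto_subseq (x := fun m => normalizedGram A (x m))
    fun m => hKsub ⟨x m, by simp [hx1 m], rfl⟩
  -- The images converge along `φ` by compactness, and the vectors differ from their images by a
  -- null sequence.
  have hxy : Tendsto (fun m => x (φ m)) atTop (𝓝 y) := by
    simpa using hy.sub (hdiff.comp hφ.tendsto_atTop)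
  refine ⟨y, ?_, ?_⟩
  · exact tendsto_nhds_unique hxy.norm (by simp [hx1])
  · exact tendsto_nhds_unique (((normalizedGram A).continuous.tendsto y).comp hxy) hy

end TopSingularVector

/-! ### Measurable choice of a top singular pair. -/

section Measurable

variable {𝕜 : Type*} [RCLike 𝕜] {Ξ : Type*} [MeasurableSpace Ξ]
  {H : Type*} [NormedAddCommGroup H] [InnerProductSpace 𝕜 H] [CompleteSpace H]
  [TopologicalSpace.SeparableSpace H] [MeasurableSpace H] [BorelSpace H]

/-- The measurability of a family of operators that is passed on by deflation: the operators and
their adjoints map measurable families of vectors to such families, and the singular values are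
measurable. -/
structure IsMeasurableFamily (A : Ξ → H →L[𝕜] H) : Prop where
  apply : ∀ f : Ξ → H, Measurable f → Measurable fun ξ => A ξ (f ξ)
  adjoint_apply : ∀ f : Ξ → H, Measurable f → Measurable fun ξ => adjoint (A ξ) (f ξ)
  singularValue : ∀ k, Measurable fun ξ => singularValue (A ξ) k

theorem isMeasurableFamily_of_measurable {A : Ξ → H →L[𝕜] H} (hA : Measurable A) :
    IsMeasurableFamily A := by
  have : SecondCountableTopology H := UniformSpace.secondCountable_of_separable H
  have happ : ∀ B : Ξ → H →L[𝕜] H, Measurable B → ∀ f : Ξ → H, Measurable f →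
      Measurable fun ξ => B ξ (f ξ) := fun B hB f hf =>
    (measurable_apply₂ (𝕜 := 𝕜) (E := H) (F := H)).comp (hB.prodMk hf)
  refine ⟨happ A hA, happ _ ?_, fun k => (continuous_singularValue k).measurable.comp hA⟩
  exact (adjoint (𝕜 := 𝕜) (E := H) (F := H)).continuous.measurable.comp hA

namespace IsMeasurableFamily

omit [TopologicalSpace.SeparableSpace H] [BorelSpace H] in
theorem norm {A : Ξ → H →L[𝕜] H} (hA : IsMeasurableFamily A) : Measurable fun ξ => ‖A ξ‖ := by
  simpa only [singularValue_zero] using hA.singularValue 0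

variable {A : Ξ → H →L[𝕜] H} (hA : IsMeasurableFamily A)
include hA

theorem normalizedGram_apply {f : Ξ → H} (hf : Measurable f) :
    Measurable fun ξ => normalizedGram (A ξ) (f ξ) := by
  have h1 : Measurable fun ξ => (((‖A ξ‖ ^ 2)⁻¹ : ℝ) : 𝕜) :=
    RCLike.measurable_ofReal.comp (hA.norm.pow_const 2).inv
  exact h1.smul (hA.adjoint_apply _ (hA.apply _ hf))

theorem exists_isTopSingularPair (hc : ∀ ξ, IsCompactOperator (A ξ)) (h0 : ∀ ξ, A ξ ≠ 0) :
    ∃ u v : Ξ → H, Measurable u ∧ Measurable v ∧ ∀ ξ, IsTopSingularPair (A ξ) (u ξ) (v ξ) := by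
  have : SecondCountableTopology H := UniformSpace.secondCountable_of_separable H
  let F : Ξ → Submodule 𝕜 H := fun ξ => (normalizedGram (A ξ)).eqLocus (1 : H →L[𝕜] H)
  let P : Ξ → H → H := fun ξ x => (F ξ).orthogonalProjectionOnto x
  have hP : ∀ x, Measurable fun ξ => P ξ x := by
    intro x
    -- Mean ergodic theorem: `P ξ x` is the limit of the Birkhoff averages, each built from finitely
    -- many measurable iterates.
    refine measurable_of_tendsto_metrizable (f := fun N ξ =>
      birkhoffAverage 𝕜 (normalizedGram (A ξ)) _root_.id N x) (fun N => ?_) ?_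
    · have hit : ∀ k : ℕ, Measurable fun ξ => (normalizedGram (A ξ))^[k] x := by
        intro k
        induction k with
        | zero => exact measurable_const
        | succ k ih =>
          simp only [Function.iterate_succ_apply']
          exact hA.normalizedGram_apply ih
      simp only [birkhoffAverage, birkhoffSum, id]
      exact (Finset.measurable_sum _ fun k _ => hit k).const_smul _
    · rw [tendsto_pi_nhds]
      intro ξ
      exact tendsto_birkhoffAverage_orthogonalProjection _ (norm_normalizedGram_le_one (A ξ)) x
  -- Were the projection zero on a dense sequence, it would vanish identically, although the fixed
  -- space contains a unit vector.
  have hne : ∀ ξ, ∃ j, P ξ (TopologicalSpace.denseSeq H j) ≠ 0 := by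
    intro ξ
    by_contra! hall
    obtain ⟨w, hw, hwfix⟩ := exists_normalizedGram_apply_eq (hc ξ) (h0 ξ)
    have hzero : P ξ = fun _ => 0 := by
      refine Continuous.ext_on (TopologicalSpace.denseRange_denseSeq H) ?_ continuous_const ?_
      · exact continuous_subtype_val.comp (F ξ).orthogonalProjectionOnto.continuous
      · rintro _ ⟨j, rfl⟩
        exact hall j
    have hPw : P ξ w = w := congrArg Subtype.val
      ((F ξ).orthogonalProjectionOnto_mem_subspace_eq_self ⟨w, hwfix⟩)
    rw [hzero] at hPw
    rw [← hPw, norm_zero] at hw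
    exact zero_ne_one hw
  classical
  let g : Ξ → H := fun ξ => P ξ (TopologicalSpace.denseSeq H (Nat.find (hne ξ)))
  have hg : Measurable g := Measurable.find (fun j => hP (TopologicalSpace.denseSeq H j))
    (fun j => (hP _ (measurableSet_singleton 0)).compl) hne
  have hg0 : ∀ ξ, g ξ ≠ 0 := fun ξ => Nat.find_spec (hne ξ)
  let u : Ξ → H := fun ξ => ((‖g ξ‖⁻¹ : ℝ) : 𝕜) • g ξ
  have hu : Measurable u := (RCLike.measurable_ofReal.comp hg.norm.inv).smul hg
  refine ⟨u, fun ξ => ((‖A ξ‖⁻¹ : ℝ) : 𝕜) • A ξ (u ξ), hu,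
    (RCLike.measurable_ofReal.comp hA.norm.inv).smul (hA.apply _ hu), fun ξ => ?_⟩
  refine isTopSingularPair_of_normalizedGram_apply_eq (h0 ξ) ?_ ?_
  · rw [norm_smul, RCLike.norm_ofReal, abs_of_nonneg (by positivity),
      inv_mul_cancel₀ (norm_ne_zero_iff.2 (hg0 ξ))]
  · have : g ξ ∈ F ξ := Submodule.coe_mem _
    exact (F ξ).smul_mem _ this

end IsMeasurableFamily

end Measurable

/-! ### Assembling singular pairs. -/

section PartialSVD

variable {𝕜 : Type*} [RCLike 𝕜] {H : Type*} [NormedAddCommGroup H] [InnerProductSpace 𝕜 H]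

theorem orthonormal_finCons {n : ℕ} {e : H} {f : Fin n → H} (he : ‖e‖ = 1)
    (hf : Orthonormal 𝕜 f) (hef : ∀ i, inner 𝕜 e (f i) = (0 : 𝕜)) :
    Orthonormal 𝕜 (Fin.cons e f : Fin (n + 1) → H) := by
  refine ⟨fun i => ?_, fun i j hij => ?_⟩
  · cases i using Fin.cases with
    | zero => exact he
    | succ i => exact hf.1 i
  · cases i using Fin.cases with
    | zero =>
      cases j using Fin.cases with
      | zero => exact absurd rfl hij
      | succ j => exact hef j
    | succ i =>
      cases j using Fin.cases with
      | zero => exact inner_eq_zero_symm.1 (hef i)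
      | succ j => exact hf.2 fun h => hij (congrArg Fin.succ h)

variable [CompleteSpace H]

/-- The families `u`, `v` are right and left singular vectors for the `n` largest singular values
of `A`, which are positive, and removing them shifts the singular values of `A` by `n`. -/
structure IsPartialSVD {n : ℕ} (A : H →L[𝕜] H) (u v : Fin n → H) : Prop where
  orthonormal_left : Orthonormal 𝕜 u
  orthonormal_right : Orthonormal 𝕜 v
  apply_left : ∀ i, A (u i) = ((singularValue A i : ℝ) : 𝕜) • v i
  adjoint_apply_right : ∀ i, adjoint A (v i) = ((singularValue A i : ℝ) : 𝕜) • u i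
  pos : ∀ i : Fin n, 0 < singularValue A i
  singularValue_sub : ∀ k,
    singularValue (A - ∑ i : Fin n, ((singularValue A i : ℝ) : 𝕜) • rankOne 𝕜 (v i) (u i)) k =
      singularValue A (k + n)

/-- Orthogonality to the new pair comes from the deflated operator killing `u` and its adjoint
killing `v`; positivity of the singular values permits the division. -/
theorem IsPartialSVD.cons {n : ℕ} {A : H →L[𝕜] H} {u v : H} {u' v' : Fin n → H} (h0 : A ≠ 0)
    (h : IsTopSingularPair A u v) (h' : IsPartialSVD (deflate A u v) u' v') :
    IsPartialSVD A (Fin.cons u u' : Fin (n + 1) → H) (Fin.cons v v' : Fin (n + 1) → H) := by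
  have hs : ∀ i : Fin n, singularValue (deflate A u v) i = singularValue A (i.succ : Fin (n + 1)) :=
    fun i => h.singularValue_deflate i
  have hne : ∀ i : Fin n, ((singularValue (deflate A u v) i : ℝ) : 𝕜) ≠ 0 :=
    fun i => RCLike.ofReal_ne_zero.2 (h'.pos i).ne'
  have hu : ∀ i, inner 𝕜 u (u' i) = (0 : 𝕜) := by
    intro i
    have e : (inner 𝕜 u (adjoint (deflate A u v) (v' i)) : 𝕜) = 0 := by
      rw [adjoint_inner_right, h.deflate_apply_left, inner_zero_left]
    rw [h'.adjoint_apply_right, inner_smul_right] at e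
    exact (mul_eq_zero.1 e).resolve_left (hne i)
  have hv : ∀ i, inner 𝕜 v (v' i) = (0 : 𝕜) := by
    intro i
    have e : (inner 𝕜 v (deflate A u v (u' i)) : 𝕜) = 0 := h.inner_deflate _
    rw [h'.apply_left, inner_smul_right] at e
    exact (mul_eq_zero.1 e).resolve_left (hne i)
  have hs0 : singularValue A ((0 : Fin (n + 1)) : ℕ) = ‖A‖ := singularValue_zero A
  refine ⟨orthonormal_finCons h.norm_left h'.orthonormal_left hu,
    orthonormal_finCons h.norm_right h'.orthonormal_right hv, fun i => ?_, fun i => ?_,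
    fun i => ?_, fun k => ?_⟩
  · cases i using Fin.cases with
    | zero => rw [hs0]; exact h.apply_left
    | succ i =>
      have e := h'.apply_left i
      rw [deflate_apply, hu, zero_smul, smul_zero, sub_zero, hs] at e
      exact e
  · cases i using Fin.cases with
    | zero => rw [hs0]; exact h.adjoint_apply_right
    | succ i =>
      have e := h'.adjoint_apply_right i
      rw [adjoint_deflate_apply, hv, zero_smul, smul_zero, sub_zero, hs] at e
      exact e
  · cases i using Fin.cases with
    | zero => rw [hs0]; exact norm_pos_iff.2 h0
    | succ i => rw [← hs]; exact h'.pos i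
  · have e := h'.singularValue_sub k
    rw [h.singularValue_deflate, add_assoc, deflate, sub_sub] at e
    rw [Fin.sum_univ_succ, ← e, hs0]
    simp only [Fin.cons_zero, Fin.cons_succ, ← hs]
    rfl

end PartialSVD

/-! ### Measurable iteration of the deflation. -/

section MeasurableSVD

variable {𝕜 : Type*} [RCLike 𝕜] {Ξ : Type*} [MeasurableSpace Ξ]
  {H : Type*} [NormedAddCommGroup H] [InnerProductSpace 𝕜 H] [CompleteSpace H]
  [TopologicalSpace.SeparableSpace H] [MeasurableSpace H] [BorelSpace H]

namespace IsMeasurableFamily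

/-- The space of bounded operators need not be separable, so norm-Borel measurability of a
difference is not automatic. Pointwise evaluations do subtract, and the shift formula supplies the
singular values. -/
theorem deflate {A : Ξ → H →L[𝕜] H} (hA : IsMeasurableFamily A) {u v : Ξ → H}
    (hu : Measurable u) (hv : Measurable v) (h : ∀ ξ, IsTopSingularPair (A ξ) (u ξ) (v ξ)) :
    IsMeasurableFamily fun ξ => deflate (A ξ) (u ξ) (v ξ) := by
  have : SecondCountableTopology H := UniformSpace.secondCountable_of_separable H
  have hc : Measurable fun ξ => ((‖A ξ‖ : ℝ) : 𝕜) := RCLike.measurable_ofReal.comp hA.norm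
  refine ⟨fun f hf => ?_, fun f hf => ?_, fun k => ?_⟩
  · simp only [deflate_apply]
    exact (hA.apply f hf).sub (hc.smul ((hu.inner hf).smul hv))
  · simp only [adjoint_deflate_apply]
    exact (hA.adjoint_apply f hf).sub (hc.smul ((hv.inner hf).smul hu))
  · simp only [fun ξ => (h ξ).singularValue_deflate k]
    exact hA.singularValue (k + 1)

theorem exists_isPartialSVD (n : ℕ) : ∀ {A : Ξ → H →L[𝕜] H}, IsMeasurableFamily A →
    (∀ ξ, IsCompactOperator (A ξ)) → (∀ ξ, (n : Cardinal) ≤ rank (A ξ)) →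
    ∃ u v : Fin n → Ξ → H, (∀ i, Measurable (u i)) ∧ (∀ i, Measurable (v i)) ∧
      ∀ ξ, IsPartialSVD (A ξ) (fun i => u i ξ) (fun i => v i ξ) := by
  induction n with
  | zero =>
    intro A _ _ _
    refine ⟨Fin.elim0, Fin.elim0, fun i => i.elim0, fun i => i.elim0, fun ξ => ?_⟩
    exact ⟨⟨fun i => i.elim0, fun i => i.elim0⟩, ⟨fun i => i.elim0, fun i => i.elim0⟩,
      fun i => i.elim0, fun i => i.elim0, fun i => i.elim0, fun k => by simp⟩
  | succ n ih =>
    intro A hA hc hr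
    have h0 : ∀ ξ, A ξ ≠ 0 := by
      intro ξ h
      have h1 := (hr ξ).trans (h ▸ rank_zero_le 0)
      have h2 : n + 1 ≤ 0 := by exact_mod_cast h1
      omega
    obtain ⟨u, v, hu, hv, h⟩ := hA.exists_isTopSingularPair hc h0
    obtain ⟨u', v', hu', hv', h'⟩ := ih (hA.deflate hu hv h)
      (fun ξ => isCompactOperator_deflate (hc ξ) _ _) (fun ξ => le_rank_deflate (hr ξ))
    refine ⟨Fin.cons u u', Fin.cons v v', Fin.cases hu hu', Fin.cases hv hv', fun ξ => ?_⟩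
    have hcons : ∀ (f : Ξ → H) (g : Fin n → Ξ → H),
        (fun i => (Fin.cons f g : Fin (n + 1) → Ξ → H) i ξ) =
          (Fin.cons (f ξ) fun i => g i ξ : Fin (n + 1) → H) := fun f g =>
      funext (Fin.cases rfl fun _ => rfl)
    rw [hcons, hcons]
    exact (h' ξ).cons (h0 ξ) (h ξ)

end IsMeasurableFamily

end MeasurableSVD

/-! ### Comparison of the Hilbert-Schmidt and operator norms. -/

section HilbertSchmidt

variable {𝕜 : Type*} [RCLike 𝕜] {H : Type*} [NormedAddCommGroup H] [InnerProductSpace 𝕜 H]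

theorem hsNorm_mono {A B : H →L[𝕜] H} (h : ∀ k, singularValue A k ≤ singularValue B k) :
    hsNorm A ≤ hsNorm B := by
  unfold hsNorm
  gcongr with k
  exact h k

theorem ofReal_norm_le_hsNorm (A : H →L[𝕜] H) : ENNReal.ofReal ‖A‖ ≤ hsNorm A := by
  have h := ENNReal.le_tsum (f := fun k : ℕ => ENNReal.ofReal (singularValue A k) ^ (2 : ℕ)) 0
  calc ENNReal.ofReal ‖A‖
      = (ENNReal.ofReal (singularValue A 0) ^ (2 : ℕ)) ^ (1 / 2 : ℝ) := by
        rw [singularValue_zero, ← ENNReal.rpow_natCast, ← ENNReal.rpow_mul]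
        simp
    _ ≤ _ := ENNReal.rpow_le_rpow h (by norm_num)

/-- The inclusion of the Hilbert-Schmidt operators into the bounded operators is continuous. -/
theorem continuous_toCLM : Continuous (HSOp.toCLM : HSOp 𝕜 H → H →L[𝕜] H) := by
  refine continuous_def.2 fun U hU A hA => ?_
  obtain ⟨ε, hε, hball⟩ := Metric.isOpen_iff.1 hU _ hA
  refine ⟨ENNReal.ofReal ε, ENNReal.ofReal_pos.2 hε, fun B hB => hball ?_⟩
  rw [Metric.mem_ball, dist_eq_norm]
  exact (ENNReal.ofReal_lt_ofReal_iff hε).1 ((ofReal_norm_le_hsNorm _).trans_lt hB)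

theorem isCompactOperator_svdSum {n : ℕ} (s : Fin n → ℝ≥0) (u v : Fin n → H) :
    IsCompactOperator (svdSum s u v : H →L[𝕜] H) := by
  have : (svdSum s u v : H →L[𝕜] H) ∈ compactOperator (RingHom.id 𝕜) H H :=
    Submodule.sum_mem _ fun i _ => isCompactOperator_smul_rankOne _ (v i) (u i)
  exact this

theorem rank_svdSum_le {n : ℕ} (s : Fin n → ℝ≥0) (u v : Fin n → H) :
    rank (svdSum s u v : H →L[𝕜] H) ≤ (n : Cardinal) := by
  induction n with
  | zero => simpa [svdSum] using rank_zero_le (𝕜 := 𝕜) (H := H) 0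
  | succ n ih =>
    rw [svdSum, Fin.sum_univ_succ, Nat.cast_succ, add_comm (n : Cardinal)]
    exact (rank_add_le _ _).trans (add_le_add (rank_smul_rankOne_le_one _ _ _)
      (ih (fun i => s i.succ) (fun i => u i.succ) (fun i => v i.succ)))

theorem summable_singularValue_sq {A : H →L[𝕜] H} {n : ℕ} (hA : IsCompactOperator A)
    (hr : rank A ≤ (n : Cardinal)) : Summable fun k : ℕ => singularValue A k ^ 2 := by
  refine summable_of_ne_finset_zero (s := Finset.range n) fun k hk => ?_
  rw [singularValue_eq_zero hA hr (by simpa using hk)]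
  simp

end HilbertSchmidt

/-! ### Optimality in both norms. -/

section Optimality

variable {𝕜 : Type*} [RCLike 𝕜] {H : Type*} [NormedAddCommGroup H] [InnerProductSpace 𝕜 H]

/-- The singular values as elements of `ℝ≥0`. -/
noncomputable def nnSingularValue (A : H →L[𝕜] H) (k : ℕ) : ℝ≥0 :=
  ⟨singularValue A k, singularValue_nonneg A k⟩

theorem singularValue_eq_iInf (A : H →L[𝕜] H) (n : ℕ) :
    singularValue A n =
      ⨅ L : {L : CompactOp 𝕜 H // rank (L : H →L[𝕜] H) ≤ (n : Cardinal)},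
        ‖A - (L.1 : H →L[𝕜] H)‖ := by
  rw [singularValue, iInf]
  congr 1
  ext r
  constructor
  · rintro ⟨L, hL, hr, rfl⟩
    exact ⟨⟨⟨L, hL⟩, hr⟩, rfl⟩
  · rintro ⟨L, rfl⟩
    exact ⟨L.1, L.1.2, L.2, rfl⟩

variable [CompleteSpace H]

theorem IsPartialSVD.singularValue_sub_svdSum {n : ℕ} {A : H →L[𝕜] H} {u v : Fin n → H}
    (h : IsPartialSVD A u v) (k : ℕ) :
    singularValue (A - svdSum (fun i : Fin n => nnSingularValue A i) u v) k =
      singularValue A (k + n) :=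
  h.singularValue_sub k

theorem IsPartialSVD.norm_sub_svdSum {n : ℕ} {A : H →L[𝕜] H} {u v : Fin n → H}
    (h : IsPartialSVD A u v) :
    ‖A - svdSum (fun i : Fin n => nnSingularValue A i) u v‖ =
      ⨅ L : {L : CompactOp 𝕜 H // rank (L : H →L[𝕜] H) ≤ (n : Cardinal)},
        ‖A - (L.1 : H →L[𝕜] H)‖ := by
  rw [← singularValue_eq_iInf, ← singularValue_zero, h.singularValue_sub_svdSum, zero_add]

/-- The comparison holds for each singular value separately. The infimum is attained because
`svdSum` has finite rank, hence is Hilbert-Schmidt. -/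
theorem IsPartialSVD.hsNorm_sub_svdSum {n : ℕ} {A : H →L[𝕜] H} {u v : Fin n → H}
    (h : IsPartialSVD A u v) :
    hsNorm (A - svdSum (fun i : Fin n => nnSingularValue A i) u v) =
      ⨅ L : {L : HSOp 𝕜 H // rank L.toCLM ≤ (n : Cardinal)}, hsNorm (A - L.1.toCLM) := by
  refine le_antisymm (le_iInf fun L => hsNorm_mono fun k => ?_) ?_
  · rw [h.singularValue_sub_svdSum]
    exact singularValue_add_le_sub A L.1.2.1 L.2 k
  · have hc := isCompactOperator_svdSum (𝕜 := 𝕜) (fun i : Fin n => nnSingularValue A i) u v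
    have hr := rank_svdSum_le (𝕜 := 𝕜) (fun i : Fin n => nnSingularValue A i) u v
    exact iInf_le (fun L : {L : HSOp 𝕜 H // rank L.toCLM ≤ (n : Cardinal)} =>
      hsNorm (A - L.1.toCLM)) ⟨⟨_, hc, summable_singularValue_sq hc hr⟩, hr⟩

end Optimality

/-- Measurable choice of the singular vectors for a measurable family of compact operators. -/
theorem exists_measurable_isPartialSVD {𝕜 : Type*} [RCLike 𝕜] {Ξ : Type*} [MeasurableSpace Ξ]
    {H : Type*} [NormedAddCommGroup H] [InnerProductSpace 𝕜 H] [CompleteSpace H]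
    [TopologicalSpace.SeparableSpace H] [MeasurableSpace H] [BorelSpace H] (n : ℕ)
    {A : Ξ → H →L[𝕜] H} (hA : Measurable A) (hc : ∀ ξ, IsCompactOperator (A ξ))
    (hr : ∀ ξ, (n : Cardinal) ≤ rank (A ξ)) :
    ∃ u v : Fin n → Ξ → H,
      (∀ i : Fin n, Measurable fun ξ => nnSingularValue (A ξ) i) ∧
      (∀ i, Measurable (u i)) ∧ (∀ i, Measurable (v i)) ∧
      ∀ ξ, IsPartialSVD (A ξ) (fun i => u i ξ) (fun i => v i ξ) := by
  have hfam := isMeasurableFamily_of_measurable hA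
  obtain ⟨u, v, hu, hv, h⟩ := hfam.exists_isPartialSVD n hc hr
  exact ⟨u, v, fun i => (hfam.singularValue i).subtype_mk, hu, hv, h⟩

theorem continuous_nnSingularValue {𝕜 : Type*} [RCLike 𝕜] {H : Type*} [NormedAddCommGroup H]
    [InnerProductSpace 𝕜 H] (k : ℕ) : Continuous fun A : H →L[𝕜] H => nnSingularValue A k :=
  (continuous_singularValue k).subtype_mk _

end ParamSVD

theorem theorem4p3 {𝕜 : Type*} [RCLike 𝕜] {Ξ : Type*} [MeasurableSpace Ξ]
    {H : Type*} [NormedAddCommGroup H] [InnerProductSpace 𝕜 H] [CompleteSpace H]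
    [TopologicalSpace.SeparableSpace H] [MeasurableSpace H] [BorelSpace H]
    (n : ℕ) (hn : 1 ≤ n) :
    -- compact operators, with the operator norm
    (∀ A : Ξ → ParamSVD.CompactOp 𝕜 H, Measurable A →
      (∀ ξ, (n : Cardinal) ≤ ParamSVD.rank (A ξ : H →L[𝕜] H)) →
      ∃ (s : Fin n → Ξ → ℝ≥0) (u v : Fin n → Ξ → H),
        (∀ i, Measurable (s i)) ∧ (∀ i, Measurable (u i)) ∧ (∀ i, Measurable (v i)) ∧
        (∀ ξ i, (s i ξ : ℝ) = ParamSVD.singularValue (A ξ : H →L[𝕜] H) i) ∧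
        (∀ ξ, Orthonormal 𝕜 fun i => u i ξ) ∧ (∀ ξ, Orthonormal 𝕜 fun i => v i ξ) ∧
        (∀ ξ, ‖(A ξ : H →L[𝕜] H) -
            ParamSVD.svdSum (fun i => s i ξ) (fun i => u i ξ) (fun i => v i ξ)‖ =
          ⨅ L : {L : ParamSVD.CompactOp 𝕜 H // ParamSVD.rank (L : H →L[𝕜] H) ≤ (n : Cardinal)},
            ‖(A ξ : H →L[𝕜] H) - (L.1 : H →L[𝕜] H)‖) ∧
        (∀ [TopologicalSpace Ξ], Continuous A → ∀ i, Continuous (s i))) ∧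
    -- Hilbert-Schmidt operators, with the Hilbert-Schmidt norm
    (∀ A : Ξ → ParamSVD.HSOp 𝕜 H, Measurable A →
      (∀ ξ, (n : Cardinal) ≤ ParamSVD.rank (A ξ).toCLM) →
      ∃ (s : Fin n → Ξ → ℝ≥0) (u v : Fin n → Ξ → H),
        (∀ i, Measurable (s i)) ∧ (∀ i, Measurable (u i)) ∧ (∀ i, Measurable (v i)) ∧
        (∀ ξ i, (s i ξ : ℝ) = ParamSVD.singularValue (A ξ).toCLM i) ∧
        (∀ ξ, Orthonormal 𝕜 fun i => u i ξ) ∧ (∀ ξ, Orthonormal 𝕜 fun i => v i ξ) ∧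
        (∀ ξ, ParamSVD.hsNorm ((A ξ).toCLM -
            ParamSVD.svdSum (fun i => s i ξ) (fun i => u i ξ) (fun i => v i ξ)) =
          ⨅ L : {L : ParamSVD.HSOp 𝕜 H // ParamSVD.rank L.toCLM ≤ (n : Cardinal)},
            ParamSVD.hsNorm ((A ξ).toCLM - L.1.toCLM)) ∧
        (∀ [TopologicalSpace Ξ], Continuous A → ∀ i, Continuous (s i))) := by
  refine ⟨fun A hA hr => ?_, fun A hA hr => ?_⟩
  · obtain ⟨u, v, hs, hu, hv, h⟩ := ParamSVD.exists_measurable_isPartialSVD n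
      (measurable_subtype_coe.comp hA) (fun ξ => (A ξ).2) hr
    exact ⟨_, u, v, hs, hu, hv, fun _ _ => rfl, fun ξ => (h ξ).orthonormal_left,
      fun ξ => (h ξ).orthonormal_right, fun ξ => (h ξ).norm_sub_svdSum, fun hc i =>
      (ParamSVD.continuous_nnSingularValue i).comp (continuous_subtype_val.comp hc)⟩
  · obtain ⟨u, v, hs, hu, hv, h⟩ := ParamSVD.exists_measurable_isPartialSVD n
      (ParamSVD.continuous_toCLM.measurable.comp hA) (fun ξ => (A ξ).2.1) hr
    exact ⟨_, u, v, hs, hu, hv, fun _ _ => rfl, fun ξ => (h ξ).orthonormal_left,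
      fun ξ => (h ξ).orthonormal_right, fun ξ => (h ξ).hsNorm_sub_svdSum, fun hc i =>
      (ParamSVD.continuous_nnSingularValue i).comp (ParamSVD.continuous_toCLM.comp hc)⟩
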